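/- \textbf{Terms.} $\lambda$-terms are $M ::= x \mid MM \mid \lambda x.M$ ($x$ in a countable set of variables), modulo renaming of bound variables; $\to_\beta$ is the contextual closure of $(\lambda x.M)N \to M[N/x]$ (capture-free substitution). A term is \emph{strongly normalizing} if no infinite sequence of $\beta$-reductions starts from it. \textbf{Types.} Linear types $A$ and (intersection) types $\sigma$ are given by $A ::= a \mid \sigma\to A$ and $\sigma ::= A \mid \sigma_1\wedge\dots\wedge\sigma_n$ $(n>1)$, with $a$ in a countable set of type variables. The $n$-ary connective $\wedge$ is commutative (types are identified up to permuting the components of intersections, at any depth), but neither idempotent nor associative. \textbf{Contexts.} A context $\Gamma$ is a finite set of assumptions $x:\sigma$ with pairwise distinct variables; $\mathrm{dom}(\Gamma)$ is the set of these variables; $\Gamma\,\#\,\Delta$ means $\mathrm{dom}(\Gamma)\cap\mathrm{dom}(\Delta)=\emptyset$, and $\Gamma,\Delta$ is then the union. The context $\bigwedge_{i=1}^n\Gamma_i$ declares the variables declared in some $\Gamma_i$; it assigns to $x$ the type that $\Gamma_i$ assigns to it if $x$ is declared in exactly one $\Gamma_i$, and the intersection $\sigma_{i_1}\wedge\dots\wedge\sigma_{i_k}$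 if $x$ is declared exactly in $\Gamma_{i_1},\dots,\Gamma_{i_k}$, $k>1$, with types $\sigma_{i_1},\dots,\sigma_{i_k}$. \textbf{System STI.} Sequents $\Gamma\vdash M:\sigma$ are derived by the rules \begin{itemize} \item $(Ax)$: $x:A\vdash x:A$; \item $(w)$: from $\Gamma\vdash M:\sigma$ and $x\notin\mathrm{dom}(\Gamma)$ infer $\Gamma,x:A\vdash M:\sigma$; \item $(\to I)$: from $\Gamma,x:\sigma\vdash M:A$ infer $\Gamma\vdash\lambda x.M:\sigma\to A$; \item $(\to E)$: from $\Gamma\vdash M:\sigma\to A$, $\Delta\vdash N:\sigma$ and $\Gamma\,\#\,\Delta$ infer $\Gamma,\Delta\vdash MN:A$; \item $(\wedge_n)$, $n>1$: from $\Gamma_i\vdash M:\sigma_i$ $(1\le i\le n)$ infer $\bigwedge_{i=1}^n\Gamma_i\vdash M:\sigma_1\wedge\dots\wedge\sigma_n$; \item $(m)$, $n>1$: from $\Gamma,x_1:\sigma_1,\dots,x_n:\sigma_n\vdash M:\tau$ (with $x_1,\dots,x_n$ distinct) and $x\notin\mathrm{dom}(\Gamma)$ infer $\Gamma,x:\sigma_1\wedge\dots\wedge\sigma_n\vdash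 M[x/x_1,\dots,x/x_n]:\tau$. \end{itemize} \textbf{Property (Strong normalization).} For every $\lambda$-term $M$: there are a context $\Gamma$, a type $\sigma$ and a derivation in STI with conclusion $\Gamma\vdash M:\sigma$ if and only if $M$ is strongly normalizing. -/

import Mathlib

namespace STI

/-! ### Lambda terms and beta reduction -/

/-- Terms of the pure lambda calculus, modulo renaming of bound variables (de Bruijn indices).
A free variable is a natural number; below `k` binders the free variable `x` is written `x + k`. -/
inductive Term : Type
  | var (x : ℕ) : Term
  | app (M N : Term) : Term
  | lam (M : Term) : Term

namespace Term

/-- The renaming `ρ` of free variables, carried below one binder. -/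
def liftRen (ρ : ℕ → ℕ) : ℕ → ℕ
  | 0 => 0
  | x + 1 => ρ x + 1

/-- Simultaneous (capture-free) renaming of the free variables of a term. -/
def rename : (ℕ → ℕ) → Term → Term
  | ρ, var x => var (ρ x)
  | ρ, app M N => app (rename ρ M) (rename ρ N)
  | ρ, lam M => lam (rename (liftRen ρ) M)

/-- The substitution `s`, carried below one binder. -/
def liftSub (s : ℕ → Term) : ℕ → Term
  | 0 => var 0
  | x + 1 => rename Nat.succ (s x)

/-- Simultaneous capture-free substitution. -/
def subst : (ℕ → Term) → Term → Term
  | s, var x => s x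
  | s, app M N => app (subst s M) (subst s N)
  | s, lam M => lam (subst (liftSub s) M)

/-- `M[N/x]`, where `M` is the body of an abstraction and `x` is the abstracted variable. -/
def instantiate (M N : Term) : Term :=
  subst (fun | 0 => N | x + 1 => var x) M

/-- One step of beta reduction: the contextual closure of `(λx.M) N → M[N/x]`. -/
inductive Beta : Term → Term → Prop
  | red (M N : Term) : Beta (app (lam M) N) (instantiate M N)
  | appL {M M' : Term} (N : Term) : Beta M M' → Beta (app M N) (app M' N)
  | appR (M : Term) {N N' : Term} : Beta N N' → Beta (app M N) (app M N')
  | lam {M M' : Term} : Beta M M' → Beta (lam M) (lam M')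

/-- `M` is strongly normalizing: no infinite sequence of beta reductions starts from `M`. -/
def StronglyNormalizing (M : Term) : Prop :=
  ¬ ∃ f : ℕ → Term, f 0 = M ∧ ∀ i, Beta (f i) (f (i + 1))

end Term

/-! ### Types -/

/-- The two syntactic categories of types. -/
inductive Kind : Type
  | linear
  | general

/-- Types before the identification by commutativity of the intersection:
`A ::= a | σ → A` (linear types) and `σ ::= A | σ₁ ∧ ... ∧ σₙ` with `n > 1` (all types). -/
inductive PreTy : Kind → Type
  | var (a : ℕ) : PreTy .linear
  | arr (σ : PreTy .general) (A : PreTy .linear) : PreTy .linear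
  | ofLin (A : PreTy .linear) : PreTy .general
  | inter (n : ℕ) (hn : 1 < n) (σ : Fin n → PreTy .general) : PreTy .general

namespace PreTy

/-- Equality of types modulo commutativity of the `n`-ary intersection, at every depth.
Neither idempotence nor associativity is included. -/
inductive Eqv : {k : Kind} → PreTy k → PreTy k → Prop
  | var (a : ℕ) : Eqv (var a) (var a)
  | arr {σ τ : PreTy .general} {A B : PreTy .linear} :
      Eqv σ τ → Eqv A B → Eqv (arr σ A) (arr τ B)
  | ofLin {A B : PreTy .linear} : Eqv A B → Eqv (ofLin A) (ofLin B)
  | inter {n : ℕ} (hn : 1 < n) {σ τ : Fin n → PreTy .general} (e : Equiv.Perm (Fin n)) :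
      (∀ i, Eqv (σ i) (τ (e i))) → Eqv (inter n hn σ) (inter n hn τ)

theorem Eqv.refl {k : Kind} (σ : PreTy k) : Eqv σ σ := by
  induction σ with
  | var a => exact .var a
  | arr _ _ h1 h2 => exact .arr h1 h2
  | ofLin _ h => exact .ofLin h
  | inter n hn _ h => exact .inter hn (Equiv.refl _) h

theorem Eqv.symm {k : Kind} {σ τ : PreTy k} (h : Eqv σ τ) : Eqv τ σ := by
  induction h with
  | var a => exact .var a
  | arr _ _ h1 h2 => exact .arr h1 h2
  | ofLin _ h => exact .ofLin h
  | inter hn e _ ih =>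
    refine .inter hn e.symm fun i => ?_
    have := ih (e.symm i)
    rwa [Equiv.apply_symm_apply] at this

theorem Eqv.trans {k : Kind} {σ τ ρ : PreTy k} (h : Eqv σ τ) (h' : Eqv τ ρ) : Eqv σ ρ := by
  induction h with
  | var a => exact h'
  | arr _ _ h1 h2 =>
    cases h' with
    | arr g1 g2 => exact .arr (h1 g1) (h2 g2)
  | ofLin _ h =>
    cases h' with
    | ofLin g => exact .ofLin (h g)
  | inter hn e _ ih =>
    cases h' with
    | inter _ e' g => exact .inter hn (e.trans e') fun i => ih i (g (e i))

instance setoid (k : Kind) : Setoid (PreTy k) :=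
  ⟨Eqv, Eqv.refl, Eqv.symm, Eqv.trans⟩

end PreTy

/-- Linear types (ranged over by `A`, `B`), modulo commutativity of the intersection. -/
def LTy : Type := Quotient (PreTy.setoid .linear)

/-- All types (ranged over by `σ`, `τ`), modulo commutativity of the intersection. -/
def Ty : Type := Quotient (PreTy.setoid .general)

/-- The type variable `a`. -/
def LTy.var (a : ℕ) : LTy := Quotient.mk _ (PreTy.var a)

/-- The linear type `σ → A`. -/
def LTy.arr (σ : Ty) (A : LTy) : LTy :=
  Quotient.map₂ PreTy.arr (fun _ _ h _ _ h' => PreTy.Eqv.arr h h') σ A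

/-- A linear type, seen as a type. -/
def Ty.ofLin (A : LTy) : Ty :=
  Quotient.map PreTy.ofLin (fun _ _ h => PreTy.Eqv.ofLin h) A

/-- The intersection `σ₁ ∧ ... ∧ σₙ`, for `n > 1`. -/
noncomputable def Ty.inter {n : ℕ} (hn : 1 < n) (σ : Fin n → Ty) : Ty :=
  Quotient.mk _ (PreTy.inter n hn fun i => Quotient.out (σ i))

/-- The intersection of classes is the class of the intersection. -/
theorem Ty.inter_mk {n : ℕ} (hn : 1 < n) (σ : Fin n → PreTy .general) :
    Ty.inter hn (fun i => Quotient.mk _ (σ i)) = Quotient.mk _ (PreTy.inter n hn σ) :=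
  Quotient.sound (.inter hn (Equiv.refl _) fun i => Quotient.mk_out (σ i))

/-- The intersection is commutative. -/
theorem Ty.inter_perm {n : ℕ} (hn : 1 < n) (σ : Fin n → Ty) (e : Equiv.Perm (Fin n)) :
    Ty.inter hn (fun i => σ (e i)) = Ty.inter hn σ :=
  Quotient.sound (.inter hn e fun _ => PreTy.Eqv.refl _)

/-- The type assigned to a variable by an intersection of contexts, from the list of the types
that the individual contexts assign to it: undeclared if the list is empty, the type itself if
there is just one, and the (flat) intersection of the list if there are at least two. -/
noncomputable def Ty.combine : List Ty → Option Ty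
  | [] => none
  | [σ] => some σ
  | σ :: τ :: l => some (Ty.inter (n := (σ :: τ :: l).length) (by simp) (σ :: τ :: l).get)

/-! ### Contexts -/

/-- Contexts, as partial functions from variables to types. (The contexts of derivable sequents
have finite domain, see `Derivable.finite_dom`.) -/
def Ctx : Type := ℕ → Option Ty

namespace Ctx

/-- The domain of a context. -/
def dom (Γ : Ctx) : Set ℕ := {x | Γ x ≠ none}

/-- The empty context. -/
def empty : Ctx := fun _ => none

/-- `Γ, x : σ` (used for `x ∉ dom Γ`). -/
def extend (Γ : Ctx) (x : ℕ) (σ : Ty) : Ctx := Function.update Γ x (some σ)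

/-- `Γ, x₁ : σ₁, ..., xₙ : σₙ` (used for distinct `xᵢ ∉ dom Γ`). -/
noncomputable def extendFamily {n : ℕ} (Γ : Ctx) (x : Fin n → ℕ) (σ : Fin n → Ty) : Ctx :=
  Function.extend x (fun i => some (σ i)) Γ

/-- `Γ, x : σ` for the variable `x` bound by the innermost abstraction, which is index `0`. -/
def cons (σ : Ty) (Γ : Ctx) : Ctx
  | 0 => some σ
  | x + 1 => Γ x

/-- `Γ, Δ` (used for `Γ` and `Δ` with disjoint domains). -/
def union (Γ Δ : Ctx) : Ctx := fun x => (Γ x).or (Δ x)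

/-- The intersection `Γ₁ ∧ ... ∧ Γₙ` of contexts. -/
noncomputable def inter {n : ℕ} (Γ : Fin n → Ctx) : Ctx :=
  fun x => Ty.combine (List.ofFn fun i => Γ i x).reduceOption

end Ctx

/-! ### The type assignment system -/

/-- `Derivable Γ M σ`: there is a derivation with conclusion `Γ ⊢ M : σ`. -/
inductive Derivable : Ctx → Term → Ty → Prop
  /-- `x : A ⊢ x : A` -/
  | ax (x : ℕ) (A : LTy) :
      Derivable (Ctx.empty.extend x (.ofLin A)) (.var x) (.ofLin A)
  /-- weakening, by a linear type -/
  | weak {Γ : Ctx} {M : Term} {σ : Ty} (x : ℕ) (A : LTy) :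
      x ∉ Γ.dom → Derivable Γ M σ → Derivable (Γ.extend x (.ofLin A)) M σ
  /-- introduction of the arrow -/
  | arrI {Γ : Ctx} {M : Term} {σ : Ty} {A : LTy} :
      Derivable (Γ.cons σ) M (.ofLin A) → Derivable Γ (.lam M) (.ofLin (.arr σ A))
  /-- elimination of the arrow, for contexts with disjoint domains -/
  | arrE {Γ Δ : Ctx} {M N : Term} {σ : Ty} {A : LTy} :
      Disjoint Γ.dom Δ.dom → Derivable Γ M (.ofLin (.arr σ A)) → Derivable Δ N σ →
      Derivable (Γ.union Δ) (.app M N) (.ofLin A)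
  /-- introduction of the intersection of `n > 1` types -/
  | inter {n : ℕ} (hn : 1 < n) {Γ : Fin n → Ctx} {M : Term} {σ : Fin n → Ty} :
      (∀ i, Derivable (Γ i) M (σ i)) → Derivable (Ctx.inter Γ) M (.inter hn σ)
  /-- the multiplexor: the distinct variables `xᵢ : σᵢ` are all replaced by
  `x : σ₁ ∧ ... ∧ σₙ` -/
  | mux {n : ℕ} (hn : 1 < n) {Γ : Ctx} {M : Term} {τ : Ty}
      (y : Fin n → ℕ) (σ : Fin n → Ty) (x : ℕ) :
      Function.Injective y → (∀ i, y i ∉ Γ.dom) → x ∉ Γ.dom →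
      Derivable (Γ.extendFamily y σ) M τ →
      Derivable (Γ.extend x (.inter hn σ)) (M.rename (Function.extend y (fun _ => x) id)) τ

/-- `M` is typable: some sequent `Γ ⊢ M : σ` is derivable. -/
def Typable (M : Term) : Prop := ∃ (Γ : Ctx) (σ : Ty), Derivable Γ M σ

/-- The contexts of derivable sequents are finite. -/
theorem Derivable.finite_dom {Γ : Ctx} {M : Term} {σ : Ty} (h : Derivable Γ M σ) :
    Γ.dom.Finite := by
  have key : ∀ (Γ : Ctx) (x : ℕ) (σ : Ty), Γ.dom.Finite → (Γ.extend x σ).dom.Finite := by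
    intro Γ x σ h
    refine (h.insert x).subset fun y hy => ?_
    by_cases hyx : y = x
    · exact Or.inl hyx
    · refine Or.inr ?_
      intro hΓ
      exact hy ((Function.update_of_ne hyx _ _).trans hΓ)
  induction h with
  | ax x A => exact key _ _ _ (by simp [Ctx.dom, Ctx.empty])
  | weak x A _ _ ih => exact key _ _ _ ih
  | arrI _ ih =>
    exact (ih.preimage (f := Nat.succ) Nat.succ_injective.injOn).subset fun y hy => hy
  | arrE _ _ _ ih1 ih2 =>
    refine (ih1.union ih2).subset fun y hy => ?_
    by_contra hc
    simp only [Ctx.dom, Set.mem_union, Set.mem_ofPred_eq, not_or, not_not] at hc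
    exact hy (by simp [Ctx.union, hc.1, hc.2])
  | @inter n hn Γ M σ _ ih =>
    refine (Set.finite_iUnion ih).subset fun y hy => ?_
    by_contra hc
    simp only [Ctx.dom, Set.mem_iUnion, Set.mem_ofPred_eq, not_exists, not_not] at hc
    refine hy ?_
    have : (List.ofFn fun i => Γ i y).reduceOption = [] := by
      simp [hc, List.ofFn_const, List.reduceOption]
    simp [Ctx.inter, this, Ty.combine]
  | @mux n hn Γ M τ y σ x hy hyd hx _ ih =>
    refine key _ _ _ (ih.subset fun z hz => ?_)
    have hz' : ¬ ∃ i, y i = z := by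
      rintro ⟨i, rfl⟩
      exact hyd i hz
    intro hΓ
    exact hz ((Function.extend_apply' _ _ _ hz').symm.trans hΓ)

end STI

/-! Typable terms normalize by reducibility candidates. An intersection is read as a set
intersection, so multiplicities and nesting disappear: the interpretation is invariant under
permuting components, and the multiplexor and the intersection of contexts only require membership
in each component. `Derivable.subst_mem_interp` is adequacy, and the identity substitution
concludes.

Conversely, types are built backwards along reduction. Without idempotence and associativity an
intersection records how the occurrences of a variable are grouped, so the argument uses the system
`Occ`, whose derivations follow the term and group occurrences along it. `Occ.expand` pulls a typing
of `M.subst s` back to `M`; this gives expansion of head redexes, provided the argument, possibly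
erased, has a linear type of its own. An induction on accessibility, then on the size of subterms,
types every strongly normalizing term. Finally `Occ.derivable` returns to STI: variables shared in
an application are renamed apart in the argument, and the multiplexor merges the copies. -/

namespace STI

/-! ### Algebra of renaming and substitution -/

namespace Term

theorem liftRen_comp (ρ ρ' : ℕ → ℕ) : liftRen ρ ∘ liftRen ρ' = liftRen (ρ ∘ ρ') := by
  funext x; cases x <;> rfl

theorem liftRen_id : liftRen id = id := by
  funext x; cases x <;> rfl

theorem liftSub_comp_liftRen (s : ℕ → Term) (ρ : ℕ → ℕ) :
    liftSub s ∘ liftRen ρ = liftSub (s ∘ ρ) := by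
  funext x; cases x <;> rfl

theorem liftSub_var : liftSub var = var := by
  funext x; cases x <;> rfl

theorem rename_id (M : Term) : M.rename id = M := by
  induction M with
  | var x => rfl
  | app M N ihM ihN => simp [rename, ihM, ihN]
  | lam M ih => simp [rename, liftRen_id, ih]

theorem rename_rename (ρ ρ' : ℕ → ℕ) (M : Term) :
    (M.rename ρ').rename ρ = M.rename (ρ ∘ ρ') := by
  induction M generalizing ρ ρ' with
  | var x => rfl
  | app M N ihM ihN => simp [rename, ihM, ihN]
  | lam M ih => simp [rename, ih, liftRen_comp]

theorem subst_rename (s : ℕ → Term) (ρ : ℕ → ℕ) (M : Term) :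
    (M.rename ρ).subst s = M.subst (s ∘ ρ) := by
  induction M generalizing s ρ with
  | var x => rfl
  | app M N ihM ihN => simp [rename, subst, ihM, ihN]
  | lam M ih => simp [rename, subst, ih, liftSub_comp_liftRen]

theorem rename_subst (s : ℕ → Term) (ρ : ℕ → ℕ) (M : Term) :
    (M.subst s).rename ρ = M.subst (rename ρ ∘ s) := by
  induction M generalizing s ρ with
  | var x => rfl
  | app M N ihM ihN => simp [rename, subst, ihM, ihN]
  | lam M ih =>
    simp only [rename, subst, ih, lam.injEq]
    congr 1
    funext x
    cases x with
    | zero => rfl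
    | succ x =>
      simp only [Function.comp, liftSub, rename_rename]
      congr 1

theorem subst_subst (s t : ℕ → Term) (M : Term) :
    (M.subst t).subst s = M.subst (fun x => (t x).subst s) := by
  induction M generalizing s t with
  | var x => rfl
  | app M N ihM ihN => simp [subst, ihM, ihN]
  | lam M ih =>
    simp only [subst, ih, lam.injEq]
    congr 1
    funext x
    cases x with
    | zero => rfl
    | succ x =>
      simp only [liftSub, subst_rename, rename_subst]
      congr 1

theorem subst_var (M : Term) : M.subst var = M := by
  induction M with
  | var x => rfl
  | app M N ihM ihN => simp [subst, ihM, ihN]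
  | lam M ih => simp [subst, liftSub_var, ih]

theorem subst_instantiate (s : ℕ → Term) (M N : Term) :
    (M.instantiate N).subst s = (M.subst (liftSub s)).instantiate (N.subst s) := by
  simp only [instantiate, subst_subst]
  congr 1
  funext x
  cases x with
  | zero => rfl
  | succ x =>
    simp only [liftSub, subst_rename, subst]
    exact (subst_var _).symm

/-- Substitution of `N` for the innermost bound variable and of `s` for the free variables. -/
theorem instantiate_subst_liftSub (s : ℕ → Term) (M N : Term) :
    (M.subst (liftSub s)).instantiate N = M.subst (fun | 0 => N | x + 1 => s x) := by
  simp only [instantiate, subst_subst]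
  congr 1
  funext x
  cases x with
  | zero => rfl
  | succ x =>
    simp only [liftSub, subst_rename]
    exact subst_var _

theorem Beta.subst {M M' : Term} (h : Beta M M') (s : ℕ → Term) :
    Beta (M.subst s) (M'.subst s) := by
  induction h generalizing s with
  | red M N => rw [subst_instantiate]; exact .red _ _
  | appL N _ ih => exact .appL _ (ih s)
  | appR M _ ih => exact .appR _ (ih s)
  | lam _ ih => exact .lam (ih _)

/-! ### Accessibility and reducibility candidates -/

/-- Accessibility for beta reduction, the inductive form of strong normalization. -/
def BetaAcc (M : Term) : Prop := Acc (fun N M => Beta M N) M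

theorem stronglyNormalizing_iff_betaAcc (M : Term) : M.StronglyNormalizing ↔ M.BetaAcc :=
  not_iff_comm.1 not_acc_iff_exists_descending_chain

/-- A reduction sequence from `M` maps step by step to one from `f M`. -/
theorem BetaAcc.of_map {f : Term → Term} (hf : ∀ {M N}, Beta M N → Beta (f M) (f N)) {M : Term}
    (h : (f M).BetaAcc) : M.BetaAcc := by
  unfold BetaAcc at *
  generalize hM : f M = P at h
  induction h generalizing M with
  | intro P _ ih => exact ⟨_, fun N hN => ih (f N) (hM ▸ hf hN) rfl⟩

/-- A term is neutral if it is not an abstraction. -/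
def Neutral : Term → Prop
  | lam _ => False
  | _ => True

/-- Reducibility candidates. -/
structure IsCandidate (R : Set Term) : Prop where
  acc : ∀ M ∈ R, M.BetaAcc
  closed : ∀ M ∈ R, ∀ N, Beta M N → N ∈ R
  neutral : ∀ M, M.Neutral → (∀ N, Beta M N → N ∈ R) → M ∈ R

theorem IsCandidate.var_mem {R : Set Term} (h : IsCandidate R) (x : ℕ) : var x ∈ R :=
  h.neutral _ trivial fun _ hN => nomatch hN

theorem isCandidate_betaAcc : IsCandidate {M | M.BetaAcc} where
  acc _ h := h
  closed _ h _ hN := h.inv hN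
  neutral _ _ h := ⟨_, h⟩

/-- Applying to a variable, which lies in every candidate, transfers accessibility back from `S`.
With a neutral function the application is no redex, and induction on the accessible argument treats
its reducts. -/
theorem IsCandidate.arrow {R S : Set Term} (hR : IsCandidate R) (hS : IsCandidate S) :
    IsCandidate {M | ∀ N ∈ R, app M N ∈ S} where
  acc M hM := (hS.acc _ (hM _ (hR.var_mem 0))).of_map (f := fun M => app M (var 0))
    fun h => .appL _ h
  closed M hM M' h N hN := hS.closed _ (hM N hN) _ (.appL _ h)
  neutral M hn hM N hN := by
    have hacc := hR.acc _ hN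
    unfold BetaAcc at hacc
    induction hacc with
    | intro N _ ih =>
      refine hS.neutral _ trivial fun P hP => ?_
      cases hP with
      | red _ _ => exact hn.elim
      | appL _ h => exact hM _ h N hN
      | appR _ h => exact ih _ h (hR.closed _ hN _ h)

theorem IsCandidate.iInter {ι : Type*} [Nonempty ι] {R : ι → Set Term}
    (h : ∀ i, IsCandidate (R i)) : IsCandidate {M | ∀ i, M ∈ R i} where
  acc _ hM := (h (Classical.arbitrary ι)).acc _ (hM _)
  closed _ hM _ hN i := (h i).closed _ (hM i) _ hN
  neutral _ hn hM i := (h i).neutral _ hn fun N hN => hM N hN i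

/-- Induction on the accessibility of the body, then of the argument, puts every one-step reduct of
the neutral application in `S`. The body is accessible because its instance at a variable is. -/
theorem IsCandidate.lam_mem {R S : Set Term} (hR : IsCandidate R) (hS : IsCandidate S) {M : Term}
    (hM : ∀ N ∈ R, M.instantiate N ∈ S) : ∀ N ∈ R, app (lam M) N ∈ S := by
  have hMacc : M.BetaAcc := (hS.acc _ (hM _ (hR.var_mem 0))).of_map
    (f := fun M => M.instantiate (var 0)) fun h => h.subst _
  unfold BetaAcc at hMacc
  induction hMacc with
  | intro M _ ihM =>
    intro N hN
    have hNacc := hR.acc _ hN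
    unfold BetaAcc at hNacc
    induction hNacc with
    | intro N _ ihN =>
      refine hS.neutral _ trivial fun P hP => ?_
      cases hP with
      | red _ _ => exact hM N hN
      | appL _ h =>
        cases h with
        | lam h => exact ihM _ h (fun Q hQ => hS.closed _ (hM Q hQ) _ (h.subst _)) N hN
      | appR _ h => exact ihN _ h (hR.closed _ hN _ h)

end Term

/-! ### Interpretation of types and adequacy -/

open Term

/-- The interpretation of types as sets of terms. -/
def PreTy.interp : {k : Kind} → PreTy k → Set Term
  | _, .var _ => {M | M.BetaAcc}
  | _, .arr σ A => {M | ∀ N ∈ σ.interp, app M N ∈ A.interp}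
  | _, .ofLin A => A.interp
  | _, .inter _ _ σ => {M | ∀ i, M ∈ (σ i).interp}

theorem PreTy.isCandidate_interp {k : Kind} (σ : PreTy k) : IsCandidate σ.interp := by
  induction σ with
  | var a => exact isCandidate_betaAcc
  | arr σ A ih1 ih2 => exact ih1.arrow ih2
  | ofLin A ih => exact ih
  | inter n hn σ ih =>
    have : Nonempty (Fin n) := ⟨⟨0, by omega⟩⟩
    exact .iInter ih

/-- Permuting components does not change a set intersection; this lets the interpretation descend to
the quotients. -/
theorem PreTy.Eqv.interp_eq {k : Kind} {σ τ : PreTy k} (h : Eqv σ τ) : σ.interp = τ.interp := by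
  induction h with
  | var a => rfl
  | arr _ _ h1 h2 => simp only [PreTy.interp, h1, h2]
  | ofLin _ h => exact h
  | inter hn e _ ih =>
    ext M
    simp only [PreTy.interp, Set.mem_ofPred_eq, ih]
    exact e.forall_congr_left.trans (by simp)

/-- The interpretation of linear types. -/
def LTy.interp (A : LTy) : Set Term :=
  Quotient.lift PreTy.interp (fun _ _ h => PreTy.Eqv.interp_eq h) A

/-- The interpretation of types. -/
def Ty.interp (σ : Ty) : Set Term :=
  Quotient.lift PreTy.interp (fun _ _ h => PreTy.Eqv.interp_eq h) σ

theorem LTy.isCandidate_interp (A : LTy) : IsCandidate A.interp :=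
  Quotient.inductionOn A fun A => A.isCandidate_interp

theorem Ty.isCandidate_interp (σ : Ty) : IsCandidate σ.interp :=
  Quotient.inductionOn σ fun σ => σ.isCandidate_interp

theorem LTy.interp_arr (σ : Ty) (A : LTy) :
    (LTy.arr σ A).interp = {M | ∀ N ∈ σ.interp, app M N ∈ A.interp} :=
  Quotient.inductionOn₂ σ A fun _ _ => rfl

theorem Ty.interp_ofLin (A : LTy) : (Ty.ofLin A).interp = A.interp :=
  Quotient.inductionOn A fun _ => rfl

theorem Ty.interp_inter {n : ℕ} (hn : 1 < n) (σ : Fin n → Ty) :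
    (Ty.inter hn σ).interp = {M | ∀ i, M ∈ (σ i).interp} := by
  -- `Ty.inter` is built from chosen representatives, so the components are first rewritten to
  -- these.
  have h : ∀ i, (σ i).interp = (Quotient.out (σ i)).interp := fun i => by
    conv_lhs => rw [← Quotient.out_eq (σ i)]
    rfl
  simp only [h]
  rfl

theorem Ty.mem_interp_of_combine {l : List Ty} {σ : Ty} (h : Ty.combine l = some σ) {M : Term}
    (hM : M ∈ σ.interp) : ∀ τ ∈ l, M ∈ τ.interp := by
  match l, h with
  | [σ], h => cases h; simpa using hM
  | σ :: τ :: l, h =>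
    cases h
    rw [Ty.interp_inter] at hM
    intro ρ hρ
    obtain ⟨i, rfl⟩ := List.get_of_mem hρ
    exact hM i

theorem Ty.exists_combine {l : List Ty} (h : l ≠ []) : ∃ σ, Ty.combine l = some σ := by
  match l, h with
  | [σ], _ => exact ⟨_, rfl⟩
  | σ :: τ :: l, _ => exact ⟨_, rfl⟩

/-- A substitution satisfies a context if it realizes the declared types. -/
def Ctx.Satisfies (s : ℕ → Term) (Γ : Ctx) : Prop := ∀ x σ, Γ x = some σ → s x ∈ σ.interp

theorem Ctx.extend_self (Γ : Ctx) (x : ℕ) (σ : Ty) : Γ.extend x σ x = some σ :=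
  Function.update_self ..

theorem Ctx.extend_of_ne (Γ : Ctx) {x y : ℕ} (h : y ≠ x) (σ : Ty) : Γ.extend x σ y = Γ y :=
  Function.update_of_ne h ..

theorem Ctx.extendFamily_apply {n : ℕ} (Γ : Ctx) {y : Fin n → ℕ} (hy : Function.Injective y)
    (σ : Fin n → Ty) (i : Fin n) : Γ.extendFamily y σ (y i) = some (σ i) :=
  hy.extend_apply (fun i => some (σ i)) (Γ : ℕ → Option Ty) i

theorem Ctx.extendFamily_of_notMem {n : ℕ} (Γ : Ctx) {y : Fin n → ℕ} (σ : Fin n → Ty) {z : ℕ}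
    (hz : ¬ ∃ i, y i = z) : Γ.extendFamily y σ z = Γ z :=
  Function.extend_apply' (fun i => some (σ i)) (Γ : ℕ → Option Ty) z hz

theorem Ctx.Satisfies.of_extend {s : ℕ → Term} {Γ : Ctx} {x : ℕ} {σ : Ty} (hx : x ∉ Γ.dom)
    (h : Satisfies s (Γ.extend x σ)) : Satisfies s Γ := fun y τ hy => by
  have : y ≠ x := by
    rintro rfl
    exact hx (by simp [Ctx.dom, hy])
  exact h y τ (by rw [Ctx.extend_of_ne _ this, hy])

/-- Adequacy of the interpretation. -/
theorem Derivable.subst_mem_interp {Γ : Ctx} {M : Term} {σ : Ty} (h : Derivable Γ M σ)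
    (s : ℕ → Term) (hs : Ctx.Satisfies s Γ) : M.subst s ∈ σ.interp := by
  induction h generalizing s with
  | ax x A => exact hs x _ (Ctx.extend_self ..)
  | weak x A hx _ ih => exact ih s (hs.of_extend hx)
  | @arrI Γ M σ A _ ih =>
    rw [Ty.interp_ofLin, LTy.interp_arr]
    rw [Ty.interp_ofLin] at ih
    refine σ.isCandidate_interp.lam_mem A.isCandidate_interp fun N hN => ?_
    rw [instantiate_subst_liftSub]
    refine ih _ fun x τ hx => ?_
    cases x with
    | zero => cases hx; exact hN
    | succ x => exact hs x τ hx
  | @arrE Γ Δ M N σ A hd _ _ ihM ihN =>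
    rw [Ty.interp_ofLin, LTy.interp_arr] at ihM
    rw [Ty.interp_ofLin]
    refine ihM s (fun x τ hx => hs x τ (by simp [Ctx.union, hx])) _
      (ihN s fun x τ hx => hs x τ ?_)
    have : Γ x = none := by
      by_contra hc
      exact Set.disjoint_left.1 hd hc (by simp [Ctx.dom, hx])
    simp [Ctx.union, this, hx]
  | @inter n hn Γ M σ _ ih =>
    rw [Ty.interp_inter]
    refine fun i => ih i s fun x τ hx => ?_
    have hτ : τ ∈ (List.ofFn fun i => Γ i x).reduceOption := by
      rw [List.reduceOption_mem_iff, List.mem_ofFn]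
      exact ⟨i, hx⟩
    obtain ⟨ρ, hρ⟩ := Ty.exists_combine (List.ne_nil_of_mem hτ)
    exact Ty.mem_interp_of_combine hρ (hs x ρ hρ) τ hτ
  | @mux n hn Γ M τ y σ x hy hyd hx _ ih =>
    -- Composing `s` with the renaming sends each `y i` to `s x`, which realizes all the components.
    rw [subst_rename]
    refine ih _ fun z ρ hz => ?_
    by_cases hzy : ∃ i, y i = z
    · obtain ⟨i, rfl⟩ := hzy
      rw [Γ.extendFamily_apply hy] at hz
      cases hz
      rw [Function.comp, hy.extend_apply]
      have := hs x _ (Ctx.extend_self ..)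
      rw [Ty.interp_inter] at this
      exact this i
    · rw [Γ.extendFamily_of_notMem _ hzy] at hz
      rw [Function.comp, Function.extend_apply' _ _ _ hzy]
      exact hs.of_extend hx z ρ hz

/-- Every candidate contains the variables, so the identity substitution satisfies any context. -/
theorem Typable.stronglyNormalizing {M : Term} (h : Typable M) : M.StronglyNormalizing := by
  obtain ⟨Γ, σ, h⟩ := h
  rw [stronglyNormalizing_iff_betaAcc, ← subst_var M]
  exact σ.isCandidate_interp.acc _
    (h.subst_mem_interp _ fun x τ _ => τ.isCandidate_interp.var_mem x)

/-! ### The syntax-directed system and its inversion -/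

theorem Ctx.inter_congr {n : ℕ} {Γ Δ : Fin n → Ctx} {x y : ℕ} (h : ∀ i, Γ i x = Δ i y) :
    inter Γ x = inter Δ y := by
  simp only [inter, h]

theorem Ctx.inter_eq_none {n : ℕ} {Γ : Fin n → Ctx} {x : ℕ} (h : ∀ i, Γ i x = none) :
    inter Γ x = none := by
  simp [inter, h, List.ofFn_const, List.reduceOption, Ty.combine]

theorem Ty.ofLin_injective : Function.Injective Ty.ofLin := by
  intro A B
  refine Quotient.inductionOn₂ A B fun A B h => ?_
  have := Quotient.exact h
  cases this with
  | ofLin h => exact Quotient.sound h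

/-- Rules out the intersection rule as the last step at a linear type, which is what makes inversion
in `Occ` possible. -/
theorem Ty.ofLin_ne_inter {n : ℕ} (hn : 1 < n) (A : LTy) (σ : Fin n → Ty) :
    Ty.ofLin A ≠ Ty.inter hn σ := by
  refine Quotient.inductionOn A fun A h => ?_
  have := Quotient.exact h
  cases this

/-- A syntax-directed variant of the type assignment system, in which exactly the variables that
occur free in the term are declared, and the contexts of an application need not be disjoint. -/
inductive Occ : Ctx → Term → Ty → Prop
  | ax (x : ℕ) (A : LTy) : Occ (Ctx.empty.extend x (.ofLin A)) (.var x) (.ofLin A)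
  | lam {Γ : Ctx} {M : Term} {σ : Ty} {A : LTy} :
      Γ 0 = some σ ∨ Γ 0 = none ∧ (∃ B, σ = .ofLin B) → Occ Γ M (.ofLin A) →
      Occ (fun x => Γ (x + 1)) (.lam M) (.ofLin (.arr σ A))
  | app {Γ Δ : Ctx} {M N : Term} {σ : Ty} {A : LTy} :
      Occ Γ M (.ofLin (.arr σ A)) → Occ Δ N σ → Occ (Ctx.inter ![Γ, Δ]) (.app M N) (.ofLin A)
  | inter {n : ℕ} (hn : 1 < n) {Γ : Fin n → Ctx} {M : Term} {σ : Fin n → Ty} :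
      (∀ i, Occ (Γ i) M (σ i)) → Occ (Ctx.inter Γ) M (.inter hn σ)

namespace Occ

theorem congr {Γ Δ : Ctx} {M : Term} {σ : Ty} (h : Occ Γ M σ) (e : ∀ x, Γ x = Δ x) : Occ Δ M σ :=
  (funext e : Γ = Δ) ▸ h

theorem var_inv {Γ : Ctx} {y : ℕ} {A : LTy} (h : Occ Γ (.var y) (.ofLin A)) :
    Γ y = some (.ofLin A) := by
  generalize hσ : Ty.ofLin A = σ at h
  cases h with
  | ax _ B => exact Ctx.extend_self ..
  | inter hn _ => exact (Ty.ofLin_ne_inter _ _ _ hσ).elim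

theorem eq_none_of_var {Γ : Ctx} {x y : ℕ} {σ : Ty} (h : Occ Γ (.var x) σ) (hy : y ≠ x) :
    Γ y = none := by
  generalize hM : Term.var x = M at h
  induction h with
  | ax z A => cases hM; exact Ctx.extend_of_ne _ hy _
  | inter _ _ ih => exact Ctx.inter_eq_none fun i => ih i hM
  | _ => cases hM

theorem app_inv {Γ : Ctx} {M N : Term} {A : LTy} (h : Occ Γ (.app M N) (.ofLin A)) :
    ∃ Γ' Δ σ, Occ Γ' M (.ofLin (.arr σ A)) ∧ Occ Δ N σ := by
  generalize hσ : Ty.ofLin A = σ at h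
  cases h with
  | app hM hN =>
    cases Ty.ofLin_injective hσ
    exact ⟨_, _, _, hM, hN⟩
  | inter hn _ => exact (Ty.ofLin_ne_inter _ _ _ hσ).elim

theorem of_combine {l : List Ty} {N : Term} (hl : ∀ τ ∈ l, ∃ Δ, Occ Δ N τ) {σ : Ty}
    (h : Ty.combine l = some σ) : ∃ Δ, Occ Δ N σ := by
  match l, h with
  | [σ], h => cases h; exact hl _ (by simp)
  | σ :: τ :: l, h =>
    cases h
    choose Δ hΔ using fun i => hl _ ((σ :: τ :: l).get_mem i)
    exact ⟨_, .inter _ hΔ⟩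

theorem of_ctx_inter {n : ℕ} {Γ : Fin n → Ctx} {x : ℕ} {N : Term}
    (hΓ : ∀ i τ, Γ i x = some τ → ∃ Δ, Occ Δ N τ) {σ : Ty}
    (h : Ctx.inter Γ x = some σ) : ∃ Δ, Occ Δ N σ := by
  refine of_combine (fun τ hτ => ?_) h
  rw [List.reduceOption_mem_iff, List.mem_ofFn] at hτ
  obtain ⟨i, hi⟩ := hτ
  exact hΓ i τ hi

/-- Holds because `Occ` declares only variables occurring in the term. The vanishing off the range
keeps index 0 out of typings of shifted terms in `expand`. -/
theorem of_rename {Γ : Ctx} {ρ : ℕ → ℕ} {M : Term} {σ : Ty} (h : Occ Γ (M.rename ρ) σ)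
    (hρ : ρ.Injective) : Occ (fun x => Γ (ρ x)) M σ ∧ ∀ y, y ∉ Set.range ρ → Γ y = none := by
  generalize hT : M.rename ρ = T at h
  induction h generalizing M ρ with
  | ax x A =>
    cases M <;> simp [rename] at hT
    subst hT
    rename_i x
    constructor
    · refine (Occ.ax x A).congr fun z => ?_
      by_cases hz : z = x
      · subst hz; simp only [Ctx.extend_self]
      · rw [Ctx.extend_of_ne _ (hρ.ne hz), Ctx.extend_of_ne _ hz]; rfl
    · intro y hy
      exact Ctx.extend_of_ne _ (fun h => hy ⟨x, h.symm⟩) _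
  | lam h0 _ ih =>
    cases M <;> simp [rename] at hT
    have hρ' : (liftRen ρ).Injective := by
      rintro (_ | x) (_ | y) hxy <;> simp_all [liftRen, hρ.eq_iff]
    obtain ⟨h1, h2⟩ := ih hρ' hT
    -- `liftRen ρ` fixes 0, so the condition on the bound variable carries over definitionally.
    refine ⟨.lam (Γ := fun x => _) (by exact h0) h1, fun y hy => h2 _ ?_⟩
    rintro ⟨_ | x, hx⟩
    · cases hx
    · exact hy ⟨x, Nat.succ_injective hx⟩
  | app _ _ ih1 ih2 =>
    cases M <;> simp [rename] at hT
    obtain ⟨h1, h1'⟩ := ih1 hρ hT.1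
    obtain ⟨h2, h2'⟩ := ih2 hρ hT.2
    constructor
    · refine (Occ.app h1 h2).congr fun x => ?_
      exact Ctx.inter_congr fun i => by fin_cases i <;> rfl
    · exact fun y hy => Ctx.inter_eq_none fun i => by
        fin_cases i
        · exact h1' y hy
        · exact h2' y hy
  | inter hn _ ih =>
    constructor
    · exact Occ.inter hn fun i => (ih i hρ hT).1
    · exact fun y hy => Ctx.inter_eq_none fun i => (ih i hρ hT).2 y hy

/-! ### Subject expansion -/

/-- The context `Θ` types the term before the substitution `s` if `Γ` types it afterwards:
every type required of `x` is a type of `s x`, and `Θ x` is `Γ y` if `s x` is a variable `y` that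
is not declared in typings of other images of `s`. -/
structure Expands (s : ℕ → Term) (Γ Θ : Ctx) : Prop where
  typed : ∀ x σ, Θ x = some σ → ∃ Δ, Occ Δ (s x) σ
  eq : ∀ x y, s x = .var y → (∀ x' ≠ x, ∀ Δ σ, Occ Δ (s x') σ → Δ y = none) → Θ x = Γ y

theorem Expands.inter {n : ℕ} {s : ℕ → Term} {Γ Θ : Fin n → Ctx}
    (h : ∀ i, Expands s (Γ i) (Θ i)) : Expands s (Ctx.inter Γ) (Ctx.inter Θ) where
  typed _ _ hx := of_ctx_inter (fun i τ => (h i).typed _ τ) hx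
  eq x y hxy hy := Ctx.inter_congr fun i => (h i).eq x y hxy hy

/-- The base case of `expand`: the type of the image becomes the type of `x`. Linear types suffice,
since `expand` splits intersections before inspecting the term. -/
theorem expand_var {Γ : Ctx} {s : ℕ → Term} {x : ℕ} {A : LTy} (h : Occ Γ (s x) (.ofLin A)) :
    ∃ Θ, Occ Θ (.var x) (.ofLin A) ∧ Expands s Γ Θ := by
  refine ⟨_, .ax x A, fun z σ hz => ?_, fun z y hzy hy => ?_⟩
  · by_cases hzx : z = x
    · subst hzx
      rw [Ctx.extend_self] at hz
      cases hz
      exact ⟨_, h⟩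
    · rw [Ctx.extend_of_ne _ hzx] at hz
      cases hz
  · by_cases hzx : z = x
    · subst hzx
      rw [hzy] at h
      rw [Ctx.extend_self, h.var_inv]
    · rw [Ctx.extend_of_ne _ hzx, hy x (Ne.symm hzx) _ _ h]
      rfl

/-- Typings of `M.subst s` come from typings of `M`. -/
theorem expand {Γ : Ctx} {M : Term} {s : ℕ → Term} {σ : Ty} (h : Occ Γ (M.subst s) σ) :
    ∃ Θ, Occ Θ M σ ∧ Expands s Γ Θ := by
  generalize hT : M.subst s = T at h
  induction h generalizing M s with
  | ax x A =>
    cases M <;> simp [subst] at hT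
    exact expand_var (hT ▸ .ax x A)
  | @lam Γ T σ A h0 hb ih =>
    cases M <;> simp [subst] at hT
    · exact expand_var (hT ▸ .lam h0 hb)
    · obtain ⟨Θ, hΘ, hE⟩ := ih hT
      have hrn : ∀ {Δ N τ}, Occ Δ (Term.rename Nat.succ N) τ →
          Occ (fun x => Δ (x + 1)) N τ ∧ Δ 0 = none := fun h =>
        have := h.of_rename Nat.succ_injective
        ⟨this.1, this.2 0 (by simp)⟩
      -- The type of the abstraction must be recovered exactly, hence the equality clause of
      -- `Expands`: index 0 is sent to itself, and the other images of `liftSub s` are shifted, so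
      -- none of their typings declares 0.
      have hΘ0 : Θ 0 = Γ 0 := by
        refine hE.eq 0 0 rfl fun x hx Δ τ hΔ => ?_
        cases x with
        | zero => exact (hx rfl).elim
        | succ x => exact (hrn hΔ).2
      rw [← hΘ0] at h0
      refine ⟨_, .lam h0 hΘ, fun x τ hx => ?_, fun x y hxy hy => ?_⟩
      · obtain ⟨Δ, hΔ⟩ := hE.typed _ _ hx
        exact ⟨_, (hrn hΔ).1⟩
      · refine hE.eq (x + 1) (y + 1) (by simp [liftSub, hxy, Term.rename]) fun x' hx' Δ τ hΔ => ?_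
        cases x' with
        | zero => exact Occ.eq_none_of_var (x := 0) hΔ (Nat.succ_ne_zero y)
        | succ x' => exact hy x' (by omega) _ _ (hrn hΔ).1
  | app h1 h2 ih1 ih2 =>
    cases M <;> simp [subst] at hT
    · exact expand_var (hT ▸ .app h1 h2)
    · obtain ⟨Θ1, h1, hE1⟩ := ih1 hT.1
      obtain ⟨Θ2, h2, hE2⟩ := ih2 hT.2
      exact ⟨_, .app h1 h2, .inter fun i => by
        fin_cases i
        · exact hE1
        · exact hE2⟩
  | inter hn _ ih =>
    choose Θ hΘ hE using fun i => ih i hT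
    exact ⟨_, .inter hn hΘ, .inter hE⟩

/-- A term that is typable by a linear type. -/
def LinTypable (M : Term) : Prop := ∃ Γ A, Occ Γ M (.ofLin A)

/-- Subject expansion at the head redex. -/
theorem beta_expand {Γ : Ctx} {M N : Term} {A : LTy} (hN : LinTypable N)
    (h : Occ Γ (M.instantiate N) (.ofLin A)) : ∃ Γ', Occ Γ' (.app (.lam M) N) (.ofLin A) := by
  obtain ⟨Θ, hΘ, hE⟩ := expand h
  cases h0 : Θ 0 with
  | none =>
    -- The argument is erased: the binder receives the argument's own linear type, as a vacuous
    -- abstraction admits no other kind.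
    obtain ⟨Δ, B, hΔ⟩ := hN
    exact ⟨_, .app (.lam (.inr ⟨h0, B, rfl⟩) hΘ) hΔ⟩
  | some σ =>
    obtain ⟨Δ, hΔ⟩ := hE.typed 0 σ h0
    exact ⟨_, .app (.lam (.inl h0) hΘ) hΔ⟩

end Occ

/-! ### Head reduction and typability of strongly normalizing terms -/

namespace Term

/-- `HeadRed M N M'`: `M` has a head redex with argument `N`, whose contraction gives `M'`. -/
inductive HeadRed : Term → Term → Term → Prop
  | red (M N : Term) : HeadRed (app (lam M) N) N (instantiate M N)
  | app {M N M' : Term} (P : Term) : HeadRed M N M' → HeadRed (app M P) N (app M' P)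

/-- Iterated applications of a variable. -/
inductive VarHead : Term → Prop
  | var (x : ℕ) : VarHead (var x)
  | app {M : Term} (N : Term) : VarHead M → VarHead (app M N)

/-- `Subterm N M`: `N` is a proper subterm of `M`. -/
inductive Subterm : Term → Term → Prop
  | appL (M N : Term) : Subterm M (app M N)
  | appR (M N : Term) : Subterm N (app M N)
  | lam (M : Term) : Subterm M (lam M)
  | trans {M N P : Term} : Subterm M N → Subterm N P → Subterm M P

theorem HeadRed.beta {M N M' : Term} (h : HeadRed M N M') : Beta M M' := by
  induction h with
  | red M N => exact .red M N
  | app P _ ih => exact .appL P ih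

theorem HeadRed.subterm {M N M' : Term} (h : HeadRed M N M') : Subterm N M := by
  induction h with
  | red M N => exact .appR _ _
  | app P _ ih => exact ih.trans (.appL _ _)

theorem head_cases (M : Term) :
    (∃ P, M = lam P) ∨ VarHead M ∨ ∃ N M', HeadRed M N M' := by
  induction M with
  | var x => exact .inr (.inl (.var x))
  | lam P => exact .inl ⟨P, rfl⟩
  | app M N ihM _ =>
    obtain ⟨P, rfl⟩ | h | ⟨Q, M', h⟩ := ihM
    · exact .inr (.inr ⟨_, _, .red P N⟩)
    · exact .inr (.inl (.app N h))
    · exact .inr (.inr ⟨_, _, .app N h⟩)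

theorem Beta.of_subterm {M N N' : Term} (h : Subterm N M) (hN : Beta N N') :
    ∃ M', Beta M M' ∧ Subterm N' M' := by
  induction h generalizing N' with
  | appL M N => exact ⟨_, .appL N hN, .appL _ _⟩
  | appR M N => exact ⟨_, .appR M hN, .appR _ _⟩
  | lam M => exact ⟨_, .lam hN, .lam _⟩
  | trans _ _ ih1 ih2 =>
    obtain ⟨P, hP, h1⟩ := ih1 hN
    obtain ⟨Q, hQ, h2⟩ := ih2 hP
    exact ⟨Q, hQ, h1.trans h2⟩

theorem Subterm.sizeOf_lt {M N : Term} (h : Subterm N M) : sizeOf N < sizeOf M := by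
  induction h with
  | trans _ _ ih1 ih2 => exact ih1.trans ih2
  | _ => simp <;> omega

end Term

namespace Occ

theorem headRed_expand {M N M' : Term} (h : HeadRed M N M') (hN : LinTypable N) {Γ : Ctx}
    {A : LTy} (hM' : Occ Γ M' (.ofLin A)) : ∃ Γ', Occ Γ' M (.ofLin A) := by
  induction h generalizing Γ A with
  | red M N => exact beta_expand hN hM'
  | app P _ ih =>
    obtain ⟨_, _, _, h1, h2⟩ := hM'.app_inv
    obtain ⟨_, h1⟩ := ih hN h1
    exact ⟨_, .app h1 h2⟩

/-- The head variable can be given any linear type, so it receives an arrow from linear types of the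
arguments to the desired `A`. -/
theorem of_varHead {M : Term} (h : VarHead M) (hs : ∀ N, Subterm N M → LinTypable N) (A : LTy) :
    ∃ Γ, Occ Γ M (.ofLin A) := by
  induction h generalizing A with
  | var x => exact ⟨_, .ax x A⟩
  | app N _ ih =>
    obtain ⟨Δ, B, hN⟩ := hs N (.appR _ _)
    obtain ⟨Γ, hM⟩ := ih (fun P hP => hs P (hP.trans (.appL _ _))) (.arr (.ofLin B) A)
    exact ⟨_, .app hM hN⟩

theorem linTypable_of_betaAcc {M : Term} (h : M.BetaAcc) : LinTypable M := by
  -- Subterms are included because the head reduct of a subterm of `M` is only a subterm of a reduct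
  -- of `M`.
  suffices H : ∀ N, N = M ∨ Subterm N M → LinTypable N from H M (.inl rfl)
  unfold BetaAcc at h
  induction h with
  | intro M _ ih =>
    intro N
    -- Passing to a body or an argument decreases the size; a head step decreases the outer
    -- induction.
    induction hs : sizeOf N using Nat.strong_induction_on generalizing N with
    | _ n ihn =>
      subst hs
      intro hNM
      have hsub : ∀ P, Subterm P N → LinTypable P := fun P hP =>
        ihn _ hP.sizeOf_lt P rfl (.inr (hNM.elim (fun h => h ▸ hP) hP.trans))
      obtain ⟨P, rfl⟩ | hv | ⟨Q, N', hh⟩ := head_cases N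
      · obtain ⟨Γ, A, hP⟩ := hsub P (.lam P)
        cases h0 : Γ 0 with
        | none => exact ⟨_, _, .lam (.inr ⟨h0, .var 0, rfl⟩) hP⟩
        | some σ => exact ⟨_, _, .lam (.inl h0) hP⟩
      · exact ⟨_, .var 0, (of_varHead hv hsub _).choose_spec⟩
      · have hN' : LinTypable N' := by
          obtain rfl | hNM := hNM
          · exact ih N' hh.beta N' (.inl rfl)
          · obtain ⟨M', hM', hs'⟩ := hh.beta.of_subterm hNM
            exact ih M' hM' N' (.inr hs')
        obtain ⟨Γ, A, hN'⟩ := hN'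
        exact ⟨_, A, (headRed_expand hh (hsub Q hh.subterm) hN').choose_spec⟩

end Occ
-- Back to STI: renaming apart and merging
namespace Derivable

theorem congr {Γ Δ : Ctx} {M : Term} {σ : Ty} (h : Derivable Γ M σ) (e : ∀ x, Γ x = Δ x) :
    Derivable Δ M σ :=
  (funext e : Γ = Δ) ▸ h

/-- A derivation declares every free variable of its term, so renaming outside the domain is
invisible. -/
theorem rename_congr {Γ : Ctx} {M : Term} {σ : Ty} (h : Derivable Γ M σ) {ρ ρ' : ℕ → ℕ}
    (hρ : ∀ x, Γ x ≠ none → ρ x = ρ' x) : M.rename ρ = M.rename ρ' := by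
  induction h generalizing ρ ρ' with
  | ax x A => simp only [rename, hρ x (by simp [Ctx.extend_self])]
  | @weak Γ M σ x A hx _ ih =>
    refine ih fun z hz => hρ z ?_
    rwa [Ctx.extend_of_ne _ (ne_of_mem_of_not_mem (s := Γ.dom) hz hx)]
  | arrI _ ih =>
    simp only [rename, Term.lam.injEq]
    refine ih fun z hz => ?_
    cases z with
    | zero => rfl
    | succ z => exact congrArg (· + 1) (hρ z hz)
  | @arrE Γ Δ M N σ A hd _ _ ih1 ih2 =>
    simp only [rename, Term.app.injEq]
    refine ⟨ih1 fun z hz => hρ z ?_, ih2 fun z hz => hρ z ?_⟩ <;> simp [Ctx.union, hz]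
  | @inter n hn Γ M σ _ ih =>
    have : Nonempty (Fin n) := ⟨⟨0, by omega⟩⟩
    let i := Classical.arbitrary (Fin n)
    refine ih i fun z hz => hρ z ?_
    obtain ⟨τ, hτ⟩ := Option.ne_none_iff_exists'.1 hz
    have : τ ∈ (List.ofFn fun i => Γ i z).reduceOption := by
      rw [List.reduceOption_mem_iff, List.mem_ofFn]
      exact ⟨i, hτ⟩
    obtain ⟨ρ, hρ⟩ := Ty.exists_combine (List.ne_nil_of_mem this)
    simp [Ctx.inter, hρ]
  | @mux n hn Γ M τ y σ x hy hyd hx _ ih =>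
    rw [rename_rename, rename_rename]
    refine ih fun z hz => ?_
    by_cases hzy : ∃ i, y i = z
    · obtain ⟨i, rfl⟩ := hzy
      simp only [Function.comp, hy.extend_apply]
      exact hρ x (by simp [Ctx.extend_self])
    · rw [Γ.extendFamily_of_notMem _ hzy] at hz
      simp only [Function.comp, Function.extend_apply' _ _ _ hzy]
      exact hρ z (by rwa [Ctx.extend_of_ne _ (ne_of_mem_of_not_mem (s := Γ.dom) hz hx)])

end Derivable

/-- A permutation of the free variables, carried below one binder. -/
def Term.liftPerm (π : Equiv.Perm ℕ) : Equiv.Perm ℕ where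
  toFun := liftRen π
  invFun := liftRen π.symm
  left_inv x := by cases x <;> simp [liftRen]
  right_inv x := by cases x <;> simp [liftRen]

theorem Ctx.extend_perm (Γ : Ctx) (π : Equiv.Perm ℕ) (x : ℕ) (σ : Ty) (z : ℕ) :
    Ctx.extend (fun x => Γ (π.symm x)) (π x) σ z = Γ.extend x σ (π.symm z) := by
  by_cases hz : z = π x
  · subst hz
    rw [Equiv.symm_apply_apply, Ctx.extend_self]
    exact Ctx.extend_self _ _ _
  · have : π.symm z ≠ x := by rwa [Ne, Equiv.symm_apply_eq]
    rw [Ctx.extend_of_ne _ this]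
    exact Ctx.extend_of_ne _ hz _

namespace Derivable

/-- Permutations preserve the injectivity and freshness conditions of the multiplexor, which
arbitrary renamings need not. Used to rename contexts apart. -/
theorem rename_perm {Γ : Ctx} {M : Term} {σ : Ty} (h : Derivable Γ M σ) (π : Equiv.Perm ℕ) :
    Derivable (fun x => Γ (π.symm x)) (M.rename π) σ := by
  induction h generalizing π with
  | ax x A => exact (Derivable.ax (π x) A).congr (Ctx.empty.extend_perm π x _)
  | @weak Γ M σ x A hx _ ih =>
    exact (Derivable.weak (π x) A (by simpa [Ctx.dom] using hx) (ih π)).congr (Γ.extend_perm π x _)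
  | @arrI Γ M σ A _ ih =>
    exact .arrI ((ih (liftPerm π)).congr fun z => by cases z <;> rfl)
  | @arrE Γ Δ M N σ A hd _ _ ih1 ih2 =>
    refine .arrE (Γ := fun x => Γ (π.symm x)) ?_ (ih1 π) (ih2 π)
    exact Set.disjoint_left.2 fun x h1 h2 => Set.disjoint_left.1 hd h1 h2
  | @inter n hn Γ M σ _ ih => exact .inter hn fun i => ih i π
  | @mux n hn Γ M τ y σ x hy hyd hx _ ih =>
    have hy' : Function.Injective (π ∘ y) := π.injective.comp hy
    have key := Derivable.mux hn (Γ := fun x => Γ (π.symm x)) (M := M.rename π) (τ := τ) (π ∘ y) σ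
      (π x) hy' (fun i => by simpa [Ctx.dom] using hyd i) (by simpa [Ctx.dom] using hx)
      ((ih π).congr fun z => ?_)
    · convert key.congr (Γ.extend_perm π x _) using 1
      rw [rename_rename, rename_rename]
      congr 1
      funext z
      by_cases hzy : ∃ i, y i = z
      · obtain ⟨i, rfl⟩ := hzy
        have := hy'.extend_apply (fun _ => π x) id i
        simp only [Function.comp, hy.extend_apply] at this ⊢
        exact this.symm
      · have : ¬ ∃ i, (π ∘ y) i = π z := by simpa using hzy
        simp only [Function.comp_apply, Function.extend_apply' _ _ _ hzy,
          Function.extend_apply' _ _ _ this, id]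
    · by_cases hzy : ∃ i, (π ∘ y) i = z
      · obtain ⟨i, rfl⟩ := hzy
        refine Eq.trans ?_ (Ctx.extendFamily_apply _ hy' σ i).symm
        simp only [Function.comp, Equiv.symm_apply_apply, Ctx.extendFamily_apply _ hy]
      · refine Eq.trans (Ctx.extendFamily_of_notMem _ _ ?_)
          (Ctx.extendFamily_of_notMem (fun x => Γ (π.symm x)) σ hzy).symm
        simpa [Equiv.eq_symm_apply] using hzy

/-- The binary multiplexor, merging `b` into `a`. -/
theorem merge {Γ : Ctx} {M : Term} {τ : Ty} (h : Derivable Γ M τ) {a b : ℕ} (hab : a ≠ b)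
    {σ σ' : Ty} (ha : Γ a = some σ) (hb : Γ b = some σ') :
    Derivable (fun z => if z = a then Ty.combine [σ, σ'] else if z = b then none else Γ z)
      (M.rename fun z => if z = b then a else z) τ := by
  have hy : Function.Injective ![a, b] := by
    intro i j
    fin_cases i <;> fin_cases j <;> simp [hab, hab.symm]
  have hval : ∀ z, (¬ ∃ i, ![a, b] i = z) ↔ z ≠ a ∧ z ≠ b := by
    intro z
    simp [Fin.exists_fin_two, eq_comm]
  -- `Ty.combine [σ, σ']` unfolds to the intersection of the family `[σ, σ'].get`, hence this choice
  -- of family.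
  have key := Derivable.mux (n := 2) one_lt_two (M := M) (τ := τ)
    (Γ := fun z => if z = a ∨ z = b then none else Γ z) ![a, b] [σ, σ'].get a hy
    (fun i => by fin_cases i <;> simp [Ctx.dom]) (by simp [Ctx.dom]) (h.congr fun z => ?_)
  · have hρ : Function.extend ![a, b] (fun _ => a) id = fun z => if z = b then a else z := by
      funext z
      by_cases hz : ∃ i, ![a, b] i = z
      · obtain ⟨i, rfl⟩ := hz
        rw [hy.extend_apply]
        fin_cases i <;> simp [hab]
      · rw [Function.extend_apply' _ _ _ hz, if_neg ((hval z).1 hz).2, id]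
    rw [hρ] at key
    refine key.congr fun z => ?_
    by_cases hz : z = a
    · subst hz
      rw [if_pos rfl]
      exact Ctx.extend_self ..
    · refine (Ctx.extend_of_ne _ hz _).trans ?_
      simp [hz]
  · by_cases hz : ∃ i, ![a, b] i = z
    · obtain ⟨i, rfl⟩ := hz
      refine Eq.trans ?_ (Ctx.extendFamily_apply _ hy _ i).symm
      fin_cases i
      · exact ha
      · exact hb
    · refine Eq.trans ?_ (Ctx.extendFamily_of_notMem _ _ hz).symm
      have := (hval z).1 hz
      simp [this.1, this.2]

/-- Merging `x + K` into `x` for every `x` in a finite set of variables below `K`. -/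
theorem merge_finset {Γ : Ctx} {M : Term} {τ : Ty} (h : Derivable Γ M τ) (K : ℕ) (s : Finset ℕ)
    (hs : ∀ x ∈ s, x < K ∧ Γ x ≠ none ∧ Γ (x + K) ≠ none) :
    Derivable (fun z => if z ∈ s then Ty.combine [Γ z, Γ (z + K)].reduceOption
        else if K ≤ z ∧ z - K ∈ s then none else Γ z)
      (M.rename fun z => if K ≤ z ∧ z - K ∈ s then z - K else z) τ := by
  induction s using Finset.induction_on with
  | empty =>
    have : (fun z : ℕ => if K ≤ z ∧ z - K ∈ (∅ : Finset ℕ) then z - K else z) = id := by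
      funext z; simp
    rw [this, rename_id]
    exact h.congr fun z => by simp
  | insert a s ha ih =>
    have ih := ih fun x hx => hs x (Finset.mem_insert_of_mem hx)
    obtain ⟨haK, h1, h2⟩ := hs a (Finset.mem_insert_self ..)
    obtain ⟨σ, h1⟩ := Option.ne_none_iff_exists'.1 h1
    obtain ⟨σ', h2⟩ := Option.ne_none_iff_exists'.1 h2
    -- Everything in `insert a s` lies below `K`, so sources and targets of the merges never
    -- overlap.
    have haK' : a + K ∉ s := fun hc => by
      have := (hs _ (Finset.mem_insert_of_mem hc)).1
      omega
    have key := ih.merge (a := a) (b := a + K) (σ := σ) (σ' := σ') (by omega)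
      (by simp [ha, haK, h1]) (by simp [haK', ha, h2])
    rw [rename_rename] at key
    have hρ : ((fun z => if z = a + K then a else z) ∘
        fun z => if K ≤ z ∧ z - K ∈ s then z - K else z) =
        fun z => if K ≤ z ∧ z - K ∈ insert a s then z - K else z := by
      funext z
      have hz : z - K ∈ s → z - K < K := fun hz => (hs _ (Finset.mem_insert_of_mem hz)).1
      simp only [Finset.mem_insert, Function.comp]
      split_ifs <;> first | omega | grind
    rw [hρ] at key
    refine key.congr fun z => ?_
    simp only [Finset.mem_insert]
    by_cases hz : z = a
    · subst hz
      simp [h1, h2, List.reduceOption]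
    · by_cases hz' : z = a + K
      · subst hz'
        have : K ≠ 0 := by omega
        simp [haK', ha, this]
      · have : z - K = a ∧ K ≤ z ↔ False := by
          constructor
          · omega
          · exact False.elim
        simp only [hz, hz', false_or, if_false]
        by_cases hzs : z ∈ s
        · simp [hzs]
        · simp only [hzs, if_false]
          by_cases hK : K ≤ z
          · have : z - K ≠ a := by omega
            simp [this]
          · simp [hK]

/-- Application without the disjointness condition. -/
theorem arrE_inter {Γ Δ : Ctx} {M N : Term} {σ : Ty} {A : LTy}
    (hM : Derivable Γ M (.ofLin (.arr σ A))) (hN : Derivable Δ N σ) :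
    Derivable (Ctx.inter ![Γ, Δ]) (.app M N) (.ofLin A) := by
  obtain ⟨K, hK⟩ := (hM.finite_dom.union hN.finite_dom).bddAbove
  replace hK : ∀ z, K < z → Γ z = none ∧ Δ z = none := by
    intro z hz
    constructor <;> by_contra hc
    · exact absurd (hK (.inl hc)) (by omega)
    · exact absurd (hK (.inr hc)) (by omega)
  obtain ⟨K, hK⟩ : ∃ K, ∀ z, K ≤ z → Γ z = none ∧ Δ z = none := ⟨K + 1, fun z hz => hK z hz⟩
  classical
  let s : Finset ℕ := (hM.finite_dom.inter_of_left Δ.dom).toFinset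
  have hs : ∀ z, z ∈ s ↔ Γ z ≠ none ∧ Δ z ≠ none := by
    intro z; simp [s, Ctx.dom]
  have hsK : ∀ z ∈ s, z < K := fun z hz => by
    by_contra hc
    exact ((hs z).1 hz).1 (hK z (by omega)).1
  -- `K` bounds both domains, so swapping `z` with `z + K` for each shared `z` is a permutation
  -- moving the shared variables of `N` away from `Γ`.
  let p : ℕ → ℕ := fun z => if z ∈ s then z + K else if K ≤ z ∧ z - K ∈ s then z - K else z
  have hp : p.Involutive := by
    intro z
    have h1 := hsK z
    have h2 := hsK (z + K)
    simp only [p]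
    split_ifs <;> first | omega | simp_all
  let π : Equiv.Perm ℕ := hp.toPerm
  have hps : ∀ z ∈ s, p (z + K) = z := fun z hz => by
    have h2 := hsK (z + K)
    have : z + K ∉ s := fun h => by have := h2 h; omega
    simp [p, this, hz]
  have hunion : Derivable (Γ.union fun z => Δ (p z)) (.app M (N.rename p)) (.ofLin A) := by
    refine .arrE (Set.disjoint_left.2 fun z h1 h2 => ?_) hM (hN.rename_perm π)
    have hzK : ¬ K ≤ z := fun hc => h1 (hK z hc).1
    by_cases hz : z ∈ s
    · refine h2 ?_
      simp only [p, hz, if_true]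
      exact (hK _ (by omega)).2
    · have : Δ z ≠ none := by simpa [Ctx.dom, p, hz, hzK] using h2
      exact hz ((hs z).2 ⟨h1, this⟩)
  have key := hunion.merge_finset K s fun z hz => by
    refine ⟨hsK z hz, ?_, ?_⟩
    · simp [Ctx.union, ((hs z).1 hz).1]
    · simp [Ctx.union, hps z hz, ((hs z).1 hz).2]
  -- Merging undoes the renaming of `N` and fixes `M`; only variables below `K` matter, as all
  -- declared ones lie there.
  have hterm : ∀ r : ℕ → ℕ, (∀ z, z < K → r z = z) → (∀ z, z < K → r (p z) = z) →
      (Term.app M (N.rename p)).rename r = .app M N := by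
    intro r h1 h2
    have hlt : ∀ z, Γ z ≠ none ∨ Δ z ≠ none → z < K := fun z hz => by
      by_contra hc
      have := hK z (by omega)
      simp [this] at hz
    rw [Term.rename, rename_rename,
      hM.rename_congr (ρ' := id) fun z hz => h1 z (hlt z (.inl hz)),
      hN.rename_congr (ρ := r ∘ p) (ρ' := id) fun z hz => h2 z (hlt z (.inr hz)), rename_id, rename_id]
  rw [hterm] at key
  · refine key.congr fun z => ?_
    have hinter : Ctx.inter ![Γ, Δ] z = Ty.combine [Γ z, Δ z].reduceOption := by
      simp [Ctx.inter]
    rw [hinter]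
    by_cases hz : z ∈ s
    · have h1 := ((hs z).1 hz).1
      have h2 := (hK (z + K) (by omega)).1
      obtain ⟨σ, h1⟩ := Option.ne_none_iff_exists'.1 h1
      simp [hz, Ctx.union, h1, h2, hps z hz]
    · rw [if_neg hz]
      split_ifs with hzK
      · simp [hK z hzK.1, List.reduceOption, Ty.combine]
      · have hpz : p z = z := by simp only [p, hz, hzK, if_false]
        simp only [Ctx.union, hpz]
        rw [hs, not_and_or, not_not, not_not] at hz
        cases h1 : Γ z <;> cases h2 : Δ z <;> simp_all [List.reduceOption, Ty.combine]
  · intro z hz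
    simp [hz]
  · intro z hz
    by_cases hzs : z ∈ s
    · simp [p, hzs]
    · have : ¬ K ≤ z := by omega
      simp [p, hzs, this]

end Derivable

theorem Occ.derivable {Γ : Ctx} {M : Term} {σ : Ty} (h : Occ Γ M σ) : Derivable Γ M σ := by
  induction h with
  | ax x A => exact .ax x A
  | @lam Γ M σ A h0 _ ih =>
    obtain h0 | ⟨h0, B, rfl⟩ := h0
    · exact .arrI (ih.congr fun z => by cases z <;> simp [Ctx.cons, h0])
    -- A vacuous binder is declared by weakening, which is why `Occ` gives it a linear type.
    · refine .arrI ((Derivable.weak 0 B (by simp [Ctx.dom, h0]) ih).congr fun z => ?_)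
      cases z with
      | zero => exact Ctx.extend_self ..
      | succ z => exact Ctx.extend_of_ne _ (Nat.succ_ne_zero z) _
  | app _ _ ih1 ih2 => exact ih1.arrE_inter ih2
  | inter hn _ ih => exact .inter hn ih

end STI

theorem mainTheorem2 (M : STI.Term) : STI.Typable M ↔ M.StronglyNormalizing := by
  refine ⟨STI.Typable.stronglyNormalizing, fun h => ?_⟩
  obtain ⟨Γ, A, hM⟩ :=
    STI.Occ.linTypable_of_betaAcc ((STI.Term.stronglyNormalizing_iff_betaAcc M).1 h)
  exact ⟨Γ, _, hM.derivable⟩
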